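/- Let $G$ be a finite simple graph. A matching of $G$ is a set of pairwise disjoint edges, $\nu(G)$ is the largest size of a matching of $G$, and a matching of that size is called maximum. Let $\mathcal N(G)$ be the null space of the real adjacency matrix of $G$, and put $$\mathrm{Supp}(G)=\{v\in V(G): x_v\neq 0\text{ for some }x\in\mathcal N(G)\},\qquad \mathrm{Core}(G)=\bigcup_{v\in \mathrm{Supp}(G)}N(v),$$ where $N(v)$ is the set of neighbours of $v$. Let $V(\mathcal F_N(G))$ be the set of vertices of $G$ that lie outside the closed neighbourhood $N[\mathrm{Supp}(G)]=\bigcup_{v\in \mathrm{Supp}(G)}(\{v\}\cup N(v))$. $G$ is unicyclic if it is connected and contains exactly one cycle. Let $G$ be unicyclic with cycle $C$. For $v\in V(C)$, the pendant tree $G\{v\}$ is the largest connected induced subgraph of $G$ that contains $v$ and no other vertex of $C$. The vertex $v$ is mismatched in $G\{v\}$ if $G\{v\}$ consists of $v$ alone or some maximum matching of $G\{v\}$ does not saturate $v$; otherwise it is matched. $G$ is of Type I if some $v\in V(C)$ is matched in $G\{v\}$, and of Type II otherwise. **Theorem.** Let $G$ be a unicyclic graph of Type II with cycle $C$, and let $T_1,\dots,T_k$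 be the connected components of $G-C$, the graph obtained from $G$ by deleting the vertices of $C$. Then $$\nu(G)=\left\lfloor\frac{|V(C)|}{2}\right\rfloor+\sum_{i=1}^{k}\left(|\mathrm{Core}(T_i)|+\frac{|V(\mathcal F_N(T_i))|}{2}\right).$$ -/

import Mathlib

namespace UnicyclicMatching

universe u

/-- The subgraph `C` of `G` is a cycle: it is traced out by a cyclic closed walk of `G`. -/
def IsCycleSubgraph {V : Type u} {G : SimpleGraph V} (C : G.Subgraph) : Prop :=
  ∃ (v : V) (p : G.Walk v v), p.IsCycle ∧ C = p.toSubgraph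

/-- A unicyclic graph: connected, with exactly one cycle (as a subgraph). -/
def IsUnicyclic {V : Type u} (G : SimpleGraph V) : Prop :=
  G.Connected ∧ ∃! C : G.Subgraph, IsCycleSubgraph C

/-- The matching number: the largest number of edges of a matching. -/
noncomputable def matchingNumber {V : Type u} (G : SimpleGraph V) : ℕ :=
  sSup {n | ∃ M : G.Subgraph, M.IsMatching ∧ M.edgeSet.ncard = n}

/-- In a finite graph the supremum in the definition of the matching number is attained. -/
theorem isGreatest_matchingNumber {V : Type u} [Finite V] (G : SimpleGraph V) :
    IsGreatest {n | ∃ M : G.Subgraph, M.IsMatching ∧ M.edgeSet.ncard = n}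
      (matchingNumber G) := by
  have hb : BddAbove {n | ∃ M : G.Subgraph, M.IsMatching ∧ M.edgeSet.ncard = n} := by
    refine ⟨(Set.univ : Set (Sym2 V)).ncard, ?_⟩
    rintro n ⟨M, -, rfl⟩
    exact Set.ncard_le_ncard (Set.subset_univ _) (Set.toFinite _)
  have hn : {n | ∃ M : G.Subgraph, M.IsMatching ∧ M.edgeSet.ncard = n}.Nonempty :=
    ⟨_, ⊥, fun v hv => absurd hv (by simp), rfl⟩
  exact ⟨Nat.sSup_mem hn hb, fun n h => le_csSup hb h⟩

/-- A maximum matching: a matching with at least as many edges as any other. -/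
def IsMaximumMatching {V : Type u} {G : SimpleGraph V} (M : G.Subgraph) : Prop :=
  M.IsMatching ∧ ∀ M' : G.Subgraph, M'.IsMatching → M'.edgeSet.ncard ≤ M.edgeSet.ncard

/-- The vertex `v` is mismatched in `G`: either `G` has only one vertex, or some maximum matching
of `G` does not saturate `v`. -/
def IsMismatched {V : Type u} (G : SimpleGraph V) (v : V) : Prop :=
  Nat.card V = 1 ∨ ∃ M : G.Subgraph, IsMaximumMatching M ∧ v ∉ M.verts

/-- The vertices of the pendant tree at `v`: those that can be reached from `v` by a walk that
meets `C` only in `v`. -/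
def pendantVerts {V : Type u} {G : SimpleGraph V} (C : G.Subgraph) (v : V) : Set V :=
  {w | ∃ p : G.Walk v w, ∀ x ∈ p.support, x ∈ C.verts → x = v}

theorem self_mem_pendantVerts {V : Type u} {G : SimpleGraph V} (C : G.Subgraph) (v : V) :
    v ∈ pendantVerts C v :=
  ⟨SimpleGraph.Walk.nil, fun x hx _ => by simpa using hx⟩

/-- The vertex set of the pendant tree at `v` is the largest vertex set that induces a connected
subgraph, contains `v`, and contains no other vertex of `C`. -/
theorem isGreatest_pendantVerts {V : Type u} {G : SimpleGraph V} (C : G.Subgraph) (v : V) :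
    IsGreatest {S : Set V | (G.induce S).Connected ∧ v ∈ S ∧ ∀ x ∈ S, x ∈ C.verts → x = v}
      (pendantVerts C v) := by
  refine ⟨⟨?_, self_mem_pendantVerts C v, ?_⟩, ?_⟩
  · refine SimpleGraph.induce_connected_of_patches v (self_mem_pendantVerts C v) ?_
    rintro w ⟨p, hp⟩
    classical
    refine ⟨{x | x ∈ p.support}, ?_, p.start_mem_support, p.end_mem_support, ?_⟩
    · intro x hx
      exact ⟨p.takeUntil x hx, fun y hy => hp y (p.support_takeUntil_subset_support hx hy)⟩
    · exact p.connected_induce_support.preconnected _ _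
  · rintro x ⟨p, hp⟩ hx
    exact hp x p.end_mem_support hx
  · rintro S ⟨hS, hv, hC⟩ w hw
    obtain ⟨q⟩ := hS.preconnected ⟨v, hv⟩ ⟨w, hw⟩
    refine ⟨q.map (SimpleGraph.Embedding.induce S).toHom, fun x hx hxC => ?_⟩
    have hx' := (SimpleGraph.Walk.support_map (SimpleGraph.Embedding.induce S).toHom q) ▸ hx
    obtain ⟨y, -, rfl⟩ := List.mem_map.1 hx'
    exact hC _ y.2 hxC

/-- The pendant tree `G{v}` of `G` at `v`, for a graph `G` with cycle `C`. -/
def pendantTree {V : Type u} {G : SimpleGraph V} (C : G.Subgraph) (v : V) :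
    SimpleGraph (pendantVerts C v) :=
  G.induce (pendantVerts C v)

/-- `G`, with cycle `C`, is of Type I: some vertex `v` of `C` is matched (that is, not mismatched)
in the pendant tree at `v`. -/
def IsTypeI {V : Type u} {G : SimpleGraph V} (C : G.Subgraph) : Prop :=
  ∃ v ∈ C.verts, ¬ IsMismatched (pendantTree C v) ⟨v, self_mem_pendantVerts C v⟩

/-- `G`, with cycle `C`, is of Type II: it is not of Type I. -/
def IsTypeII {V : Type u} {G : SimpleGraph V} (C : G.Subgraph) : Prop :=
  ¬ IsTypeI C

/-- The null space of the real adjacency matrix of a finite graph. -/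
noncomputable def nullSpace {V : Type u} [Finite V] (G : SimpleGraph V) :
    Submodule ℝ (V → ℝ) :=
  letI := Fintype.ofFinite V
  letI := Classical.decRel G.Adj
  LinearMap.ker (G.adjMatrix ℝ).mulVecLin

/-- The support of a finite graph: the vertices at which some vector of the null space does not
vanish. -/
def supp {V : Type u} [Finite V] (G : SimpleGraph V) : Set V :=
  {v | ∃ x ∈ nullSpace G, x v ≠ 0}

/-- The core: all neighbours of vertices of the support. -/
def core {V : Type u} [Finite V] (G : SimpleGraph V) : Set V :=
  ⋃ v ∈ supp G, G.neighborSet v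

/-- The vertex set of the `S`-forest: the closed neighbourhood of the support. -/
def sForestVerts {V : Type u} [Finite V] (G : SimpleGraph V) : Set V :=
  ⋃ v ∈ supp G, insert v (G.neighborSet v)

/-- The vertex set of the `N`-forest: the vertices outside the `S`-forest. -/
def nForestVerts {V : Type u} [Finite V] (G : SimpleGraph V) : Set V :=
  (sForestVerts G)ᶜ

/-- The graph `G - C` obtained from `G` by deleting the vertices of `C`. -/
def deleteCycle {V : Type u} {G : SimpleGraph V} (C : G.Subgraph) :
    SimpleGraph ((C.verts)ᶜ : Set V) :=
  G.induce (C.verts)ᶜ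

end UnicyclicMatching

namespace UnicyclicMatching

universe u

variable {V : Type u} {G : SimpleGraph V}

/-! The matching number splits as ν(G) = ⌊|V(C)|/2⌋ + ν(G - C), and G - C is a forest, where the
null decomposition computes ν.

For ≤, every edge of a maximum matching lies inside V(C) or inside one pendant tree. The first kind
number at most ⌊|V(C)|/2⌋. Type II gives each pendant tree a maximum matching missing its root;
pendant trees are disjoint, so these matchings together form a matching of G - C
(`sum_matchingNumber_pendantTree_le`). For ≥, join alternate edges of C to a maximum matching of G -
C.

For a forest, 2ν = 2|Core| + |V(F_N)| (`two_mul_matchingNumber_of_isAcyclic`) follows by induction: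
take a leaf u with neighbour p and delete all edges at p. This lowers ν by one. If u is in the
support, only p leaves the core; otherwise u and p leave the N-forest
(`two_mul_core_add_nForest_of_leaf`). -/

/-! ### Matchings as sets of edges -/

/-- A matching of `G` given by its edges: a set of pairwise disjoint edges. -/
structure IsEdgeMatching (G : SimpleGraph V) (M : Set (Sym2 V)) : Prop where
  subset : M ⊆ G.edgeSet
  eq_of_mem : ∀ e ∈ M, ∀ f ∈ M, ∀ v, v ∈ e → v ∈ f → e = f

theorem IsEdgeMatching.mono {M N : Set (Sym2 V)} (hM : IsEdgeMatching G M) (h : N ⊆ M) :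
    IsEdgeMatching G N :=
  ⟨h.trans hM.subset, fun e he f hf => hM.eq_of_mem e (h he) f (h hf)⟩

theorem isEdgeMatching_edgeSet {M : G.Subgraph} (hM : M.IsMatching) :
    IsEdgeMatching G M.edgeSet := by
  refine ⟨M.edgeSet_subset, fun e he f hf v hve hvf => ?_⟩
  obtain ⟨a, rfl⟩ := Sym2.mem_iff_exists.1 hve
  obtain ⟨b, rfl⟩ := Sym2.mem_iff_exists.1 hvf
  rw [SimpleGraph.Subgraph.mem_edgeSet] at he hf
  rw [hM.eq_of_adj_left he hf]

/-- Allows all counting to be done on edge sets, where restrictions and unions need no bookkeeping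
of vertices. -/
theorem IsEdgeMatching.exists_isMatching {M : Set (Sym2 V)} (hM : IsEdgeMatching G M) :
    ∃ N : G.Subgraph, N.IsMatching ∧ N.edgeSet = M := by
  let N : G.Subgraph :=
    { verts := {v | ∃ e ∈ M, v ∈ e}
      Adj := fun v w => s(v, w) ∈ M
      adj_sub := fun h => hM.subset h
      edge_vert := fun h => ⟨_, h, Sym2.mem_mk_left _ _⟩
      symm := ⟨fun v w h => by rwa [Sym2.eq_swap]⟩ }
  refine ⟨N, ?_, ?_⟩
  · rintro v ⟨e, he, hv⟩
    obtain ⟨a, rfl⟩ := Sym2.mem_iff_exists.1 hv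
    refine ⟨a, he, fun b hb => ?_⟩
    exact Sym2.congr_right.1
      (hM.eq_of_mem _ hb _ he v (Sym2.mem_mk_left _ _) (Sym2.mem_mk_left _ _))
  · ext e
    induction e with
    | _ a b => rfl

theorem IsEdgeMatching.ncard_le [Finite V] {M : Set (Sym2 V)} (hM : IsEdgeMatching G M) :
    M.ncard ≤ matchingNumber G := by
  obtain ⟨N, hN, rfl⟩ := hM.exists_isMatching
  exact (isGreatest_matchingNumber G).2 ⟨N, hN, rfl⟩

theorem exists_isEdgeMatching_ncard_eq [Finite V] (G : SimpleGraph V) :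
    ∃ M, IsEdgeMatching G M ∧ M.ncard = matchingNumber G := by
  obtain ⟨N, hN, h⟩ := (isGreatest_matchingNumber G).1
  exact ⟨_, isEdgeMatching_edgeSet hN, h⟩

theorem IsMaximumMatching.ncard_eq [Finite V] {M : G.Subgraph} (hM : IsMaximumMatching M) :
    M.edgeSet.ncard = matchingNumber G := by
  obtain ⟨N, hN, h⟩ := (isGreatest_matchingNumber G).1
  exact le_antisymm (isEdgeMatching_edgeSet hM.1).ncard_le (h ▸ hM.2 N hN)

/-- The edges of `M` both of whose ends lie in `S`. -/
def edgesWithin (M : Set (Sym2 V)) (S : Set V) : Set (Sym2 V) :=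
  {e | e ∈ M ∧ ∀ v ∈ e, v ∈ S}

theorem IsEdgeMatching.edgesWithin {M : Set (Sym2 V)} (hM : IsEdgeMatching G M) (S : Set V) :
    IsEdgeMatching G (edgesWithin M S) :=
  hM.mono fun _ h => h.1

theorem IsEdgeMatching.ncard_le_induce [Finite V] {M : Set (Sym2 V)} {S : Set V}
    (hM : IsEdgeMatching G M) (hS : ∀ e ∈ M, ∀ v ∈ e, v ∈ S) :
    M.ncard ≤ matchingNumber (G.induce S) := by
  have hinj : Function.Injective (Sym2.map (Subtype.val : S → V)) :=
    Sym2.map.injective Subtype.val_injective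
  have himg : Sym2.map (Subtype.val : S → V) '' (Sym2.map (Subtype.val : S → V) ⁻¹' M) = M := by
    refine Set.image_preimage_eq_of_subset fun e he => ?_
    induction e with
    | _ a b =>
      exact ⟨s(⟨a, hS _ he a (Sym2.mem_mk_left _ _)⟩, ⟨b, hS _ he b (Sym2.mem_mk_right _ _)⟩), rfl⟩
  have hM' : IsEdgeMatching (G.induce S) (Sym2.map (Subtype.val : S → V) ⁻¹' M) := by
    refine ⟨fun e he => ?_, fun e he f hf v hve hvf => hinj ?_⟩
    · induction e with
      | _ a b => exact hM.subset he
    · exact hM.eq_of_mem _ he _ hf v.1 (Sym2.mem_map.2 ⟨v, hve, rfl⟩)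
        (Sym2.mem_map.2 ⟨v, hvf, rfl⟩)
  rw [← himg, Set.ncard_image_of_injective _ hinj]
  exact hM'.ncard_le

theorem IsEdgeMatching.image_val {S : Set V} {M : Set (Sym2 S)}
    (hM : IsEdgeMatching (G.induce S) M) :
    IsEdgeMatching G (Sym2.map Subtype.val '' M) ∧
      (Sym2.map (Subtype.val : S → V) '' M).ncard = M.ncard ∧
      ∀ v : V, (∃ e ∈ Sym2.map (Subtype.val : S → V) '' M, v ∈ e) ↔
        ∃ h : v ∈ S, ∃ e ∈ M, (⟨v, h⟩ : S) ∈ e := by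
  refine ⟨⟨?_, ?_⟩, Set.ncard_image_of_injective _ (Sym2.map.injective Subtype.val_injective), ?_⟩
  · rintro _ ⟨e, he, rfl⟩
    have := hM.subset he
    induction e with
    | _ a b => exact this
  · rintro _ ⟨e, he, rfl⟩ _ ⟨f, hf, rfl⟩ v hve hvf
    obtain ⟨a, ha, rfl⟩ := Sym2.mem_map.1 hve
    obtain ⟨b, hb, hab⟩ := Sym2.mem_map.1 hvf
    obtain rfl := Subtype.val_injective hab
    rw [hM.eq_of_mem e he f hf _ ha hb]
  · intro v
    constructor
    · rintro ⟨_, ⟨e, he, rfl⟩, hv⟩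
      obtain ⟨a, ha, rfl⟩ := Sym2.mem_map.1 hv
      exact ⟨a.2, e, he, ha⟩
    · rintro ⟨h, e, he, hv⟩
      exact ⟨_, ⟨e, he, rfl⟩, Sym2.mem_map.2 ⟨_, hv, rfl⟩⟩

theorem exists_isEdgeMatching_induce [Finite V] (G : SimpleGraph V) (S : Set V) :
    ∃ M, IsEdgeMatching G M ∧ M.ncard = matchingNumber (G.induce S) ∧
      ∀ e ∈ M, ∀ v ∈ e, v ∈ S := by
  obtain ⟨M, hM, hc⟩ := exists_isEdgeMatching_ncard_eq (G.induce S)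
  obtain ⟨h1, h2, h3⟩ := hM.image_val
  exact ⟨_, h1, h2.trans hc, fun e he v hv => ((h3 v).1 ⟨e, he, hv⟩).1⟩

theorem IsEdgeMatching.iUnion [Finite V] {ι : Type*} [Fintype ι] {M : ι → Set (Sym2 V)}
    (hM : ∀ i, IsEdgeMatching G (M i))
    (hdisj : ∀ i j, i ≠ j → ∀ e ∈ M i, ∀ f ∈ M j, ∀ v ∈ e, v ∉ f) :
    IsEdgeMatching G (⋃ i, M i) ∧ (⋃ i, M i).ncard = ∑ i, (M i).ncard := by
  refine ⟨⟨Set.iUnion_subset fun i => (hM i).subset, ?_⟩, ?_⟩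
  · intro e he f hf v hve hvf
    obtain ⟨i, hi⟩ := Set.mem_iUnion.1 he
    obtain ⟨j, hj⟩ := Set.mem_iUnion.1 hf
    by_cases hij : i = j
    · subst hij
      exact (hM i).eq_of_mem e hi f hj v hve hvf
    · exact absurd hvf (hdisj i j hij e hi f hj v hve)
  · rw [Set.ncard_iUnion_of_finite (fun i => Set.toFinite _), finsum_eq_sum_of_fintype]
    intro i j hij
    refine Set.disjoint_left.2 fun e he hf => ?_
    exact hdisj i j hij e he e hf _ (Sym2.out_fst_mem e) (Sym2.out_fst_mem e)

theorem IsEdgeMatching.two_mul_ncard_le [Finite V] {M : Set (Sym2 V)} {S : Set V}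
    (hM : IsEdgeMatching G M) (hS : ∀ e ∈ M, ∀ v ∈ e, v ∈ S) : 2 * M.ncard ≤ S.ncard := by
  classical
  have hf : M.Finite := Set.toFinite M
  have hSf : S.Finite := Set.toFinite S
  rw [Set.ncard_eq_toFinset_card M hf, Set.ncard_eq_toFinset_card S hSf, mul_comm]
  rw [← Finset.sum_const_nat (f := fun e : Sym2 V => e.toFinset.card) (fun e he => ?_),
    ← Finset.card_biUnion]
  · refine Finset.card_le_card fun v hv => ?_
    obtain ⟨e, he, hv⟩ := Finset.mem_biUnion.1 hv
    exact hSf.mem_toFinset.2 (hS e (hf.mem_toFinset.1 he) v (Sym2.mem_toFinset.1 hv))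
  · intro e he f hf' hef
    refine Finset.disjoint_left.2 fun v hv hv' => hef ?_
    exact hM.eq_of_mem e (hf.mem_toFinset.1 he) f (hf.mem_toFinset.1 hf') v
      (Sym2.mem_toFinset.1 hv) (Sym2.mem_toFinset.1 hv')
  · exact Sym2.card_toFinset_of_not_isDiag e
      (G.not_isDiag_of_mem_edgeSet (hM.subset (hf.mem_toFinset.1 he)))

/-- The matching number is additive over the connected components. -/
theorem matchingNumber_eq_sum [Finite V] {ι : Type*} [Fintype ι] (e : ι ≃ G.ConnectedComponent) :
    matchingNumber G = ∑ i, matchingNumber (e i).toSimpleGraph := by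
  apply le_antisymm
  · obtain ⟨M, hM, hc⟩ := exists_isEdgeMatching_ncard_eq G
    have hU : M = ⋃ i, UnicyclicMatching.edgesWithin M (e i).supp := by
      ext f
      refine ⟨fun hf => Set.mem_iUnion.2 ?_, fun hf => ?_⟩
      · induction f with
        | _ a b =>
          have hab : G.Adj a b := hM.subset hf
          refine ⟨e.symm (G.connectedComponentMk a), hf, fun v hv => ?_⟩
          rw [e.apply_symm_apply]
          rcases Sym2.mem_iff.1 hv with rfl | rfl
          · rfl
          · exact SimpleGraph.ConnectedComponent.sound hab.symm.reachable
      · obtain ⟨i, hi⟩ := Set.mem_iUnion.1 hf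
        exact hi.1
    rw [← hc, hU]
    refine (Set.ncard_iUnion_le_of_fintype _).trans (Finset.sum_le_sum fun i _ => ?_)
    exact (hM.edgesWithin _).ncard_le_induce fun f hf => hf.2
  · choose M hM hc hS using fun i => exists_isEdgeMatching_induce G (e i).supp
    obtain ⟨h1, h2⟩ := IsEdgeMatching.iUnion hM (fun i j hij a ha b hb v hva hvb => hij <| by
      have h := hS i a ha v hva
      have h' := hS j b hb v hvb
      rw [SimpleGraph.ConnectedComponent.mem_supp_iff] at h h'
      exact e.injective (h.symm.trans h'))
    have h3 := h1.ncard_le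
    rw [h2, Finset.sum_congr rfl fun i _ => hc i] at h3
    exact h3

/-! ### Null space, core and N-forest -/

open Classical in
theorem mem_nullSpace_iff [inst : Fintype V] {x : V → ℝ} :
    x ∈ nullSpace G ↔ ∀ v, ∑ w, (if G.Adj v w then x w else 0) = 0 := by
  unfold nullSpace
  generalize Fintype.ofFinite V = i
  obtain rfl := Subsingleton.elim inst i
  rw [LinearMap.mem_ker, funext_iff]
  refine forall_congr' fun v => ?_
  rw [Matrix.mulVecLin_apply, SimpleGraph.adjMatrix_mulVec_apply,
    SimpleGraph.neighborFinset_eq_filter, Finset.sum_filter]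
  rfl

theorem mem_core_iff [Finite V] {w : V} : w ∈ core G ↔ ∃ v ∈ supp G, G.Adj v w := by
  simp [core]

theorem mem_nForestVerts_iff [Finite V] {w : V} :
    w ∈ nForestVerts G ↔ w ∉ supp G ∧ w ∉ core G := by
  simp only [nForestVerts, sForestVerts, core, Set.mem_compl_iff, Set.mem_iUnion,
    Set.mem_insert_iff, not_exists, not_or]
  constructor
  · exact fun h => ⟨fun hw => (h w hw).1 rfl, fun v hv => (h v hv).2⟩
  · rintro ⟨h1, h2⟩ v hv
    exact ⟨fun h => h1 (h ▸ hv), h2 v hv⟩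

/-! ### Removing the edges at the neighbour of a leaf -/

/-- An acyclic graph with an edge has a vertex with exactly one neighbour. -/
theorem exists_leaf [Finite V] (hG : G.IsAcyclic) (hne : G ≠ ⊥) :
    ∃ u p, ∀ w, G.Adj u w ↔ w = p := by
  classical
  obtain ⟨a, b, hab⟩ := SimpleGraph.ne_bot_iff_exists_adj.1 hne
  have := Fintype.ofFinite V
  let c := G.connectedComponentMk a
  have hb : b ∈ c.supp := SimpleGraph.ConnectedComponent.sound hab.symm.reachable
  have : Nontrivial c := ⟨⟨a, rfl⟩, ⟨b, hb⟩, fun h => hab.ne (congrArg Subtype.val h)⟩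
  have : Fintype c := Fintype.ofFinite _
  obtain ⟨v, hv⟩ := (hG.isTree_connectedComponent c).exists_vert_degree_one_of_nontrivial
  obtain ⟨w, hw, hu⟩ := SimpleGraph.degree_eq_one_iff_existsUnique_adj.1 hv
  refine ⟨v.1, w.1, fun y => ⟨fun h => ?_, fun h => h ▸ hw⟩⟩
  exact congrArg Subtype.val (hu ⟨y, c.mem_supp_of_adj_mem_supp v.2 h⟩ h)

section Leaf

variable {u p : V} (hu : ∀ w, G.Adj u w ↔ w = p)
include hu

/-- A matching has at most one edge at `p`. Conversely, once `p` is isolated so is `u`, and the edge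
`up` can be added to any matching. -/
theorem matchingNumber_deleteIncidenceSet_of_leaf [Finite V] :
    matchingNumber G = matchingNumber (G.deleteIncidenceSet p) + 1 := by
  have hup : G.Adj u p := (hu p).2 rfl
  apply le_antisymm
  · obtain ⟨M, hM, hc⟩ := exists_isEdgeMatching_ncard_eq G
    have h1 : IsEdgeMatching (G.deleteIncidenceSet p) {e | e ∈ M ∧ p ∉ e} := by
      refine ⟨fun e he => ?_, (hM.mono fun e he => he.1).eq_of_mem⟩
      obtain ⟨he, hp⟩ := he
      induction e with
      | _ a b =>
        rw [SimpleGraph.mem_edgeSet, SimpleGraph.deleteIncidenceSet_adj]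
        exact ⟨hM.subset he, fun h => hp (h ▸ Sym2.mem_mk_left _ _),
          fun h => hp (h ▸ Sym2.mem_mk_right _ _)⟩
    have h2 : {e | e ∈ M ∧ p ∈ e}.ncard ≤ 1 :=
      (Set.ncard_le_one_iff (Set.toFinite _)).2 fun he hf => hM.eq_of_mem _ he.1 _ hf.1 p he.2 hf.2
    have h3 : M = {e | e ∈ M ∧ p ∉ e} ∪ {e | e ∈ M ∧ p ∈ e} := by
      ext e
      simp only [Set.mem_union, Set.mem_ofPred_eq]
      tauto
    rw [← hc, h3]
    exact (Set.ncard_union_le _ _).trans (add_le_add h1.ncard_le h2)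
  · obtain ⟨M, hM, hc⟩ := exists_isEdgeMatching_ncard_eq (G.deleteIncidenceSet p)
    have hadj : ∀ a b, s(a, b) ∈ M → G.Adj a b ∧ a ≠ p ∧ b ≠ p := fun a b h =>
      SimpleGraph.deleteIncidenceSet_adj.1 (hM.subset h)
    have hp : ∀ e ∈ M, p ∉ e := by
      intro e he hp
      obtain ⟨b, rfl⟩ := Sym2.mem_iff_exists.1 hp
      exact (hadj _ _ he).2.1 rfl
    have hu' : ∀ e ∈ M, u ∉ e := by
      intro e he hue
      obtain ⟨b, rfl⟩ := Sym2.mem_iff_exists.1 hue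
      exact (hadj _ _ he).2.2 ((hu b).1 (hadj _ _ he).1)
    have hnew : ∀ e ∈ M, ∀ v ∈ e, v ∉ s(u, p) := by
      intro e he v hv hv'
      rcases Sym2.mem_iff.1 hv' with rfl | rfl
      exacts [hu' e he hv, hp e he hv]
    have h1 : IsEdgeMatching G (insert s(u, p) M) := by
      refine ⟨Set.insert_subset hup fun e he => ?_, ?_⟩
      · induction e with
        | _ a b => exact (hadj a b he).1
      · rintro e (rfl | he) f (rfl | hf) v hve hvf
        · rfl
        · exact absurd hve (hnew f hf v hvf)
        · exact absurd hvf (hnew e he v hve)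
        · exact hM.eq_of_mem e he f hf v hve hvf
    have h2 : s(u, p) ∉ M := fun h => hp _ h (Sym2.mem_mk_right _ _)
    rw [← hc, ← Set.ncard_insert_of_notMem h2 (Set.toFinite M)]
    exact h1.ncard_le

theorem nullSpace_apply_eq_zero_of_leaf [Finite V] {x : V → ℝ} (hx : x ∈ nullSpace G) :
    x p = 0 := by
  classical
  have := Fintype.ofFinite V
  simpa [hu] using mem_nullSpace_iff.1 hx u

/-- The equation at `u` forces `x p = 0`, so the deleted edges contributed nothing to the equations
away from `p`. -/
theorem mem_nullSpace_deleteIncidenceSet_of_leaf [Finite V] {x : V → ℝ} (hx : x ∈ nullSpace G) :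
    x ∈ nullSpace (G.deleteIncidenceSet p) := by
  classical
  have := Fintype.ofFinite V
  have hp := nullSpace_apply_eq_zero_of_leaf hu hx
  rw [mem_nullSpace_iff] at hx ⊢
  intro v
  by_cases hv : v = p
  · simp [SimpleGraph.deleteIncidenceSet_adj, hv]
  · refine Eq.trans ?_ (hx v)
    refine Finset.sum_congr rfl fun w _ => ?_
    by_cases hw : w = p
    · simp [hw, hp]
    · simp [SimpleGraph.deleteIncidenceSet_adj, hv, hw]

-- The values of `y` at `u` and `p` are discarded: the equation at `u` forces 0 at `p`, and the
-- equation at `p` then determines the value at `u`. No other equation involves `u`.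
open Classical in
theorem extend_mem_nullSpace_of_leaf [Fintype V] {y : V → ℝ}
    (hy : y ∈ nullSpace (G.deleteIncidenceSet p)) :
    (fun w => if w = p then 0 else
      if w = u then -∑ t, (if G.Adj p t ∧ t ≠ u then y t else 0) else y w) ∈ nullSpace G := by
  have hup : G.Adj u p := (hu p).2 rfl
  rw [mem_nullSpace_iff] at hy ⊢
  intro v
  by_cases hvu : v = u
  · simp [hvu, hu]
  by_cases hvp : v = p
  · subst hvp
    set s := ∑ t, (if G.Adj v t ∧ t ≠ u then y t else 0) with hs
    have : ∀ w, (if G.Adj v w then (if w = v then 0 else if w = u then -s else y w) else 0)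
        = (if w = u then -s else 0) + (if G.Adj v w ∧ w ≠ u then y w else 0) := by
      intro w
      by_cases hwu : w = u
      · subst hwu
        simp [hup.symm, hup.ne]
      · by_cases hwv : w = v
        · simp [hwv, hvu]
        · simp [hwv, hwu]
    rw [Finset.sum_congr rfl fun w _ => this w, Finset.sum_add_distrib, ← hs]
    simp
  · refine Eq.trans ?_ (hy v)
    refine Finset.sum_congr rfl fun w _ => ?_
    by_cases hwp : w = p
    · simp [hwp, SimpleGraph.deleteIncidenceSet_adj]
    by_cases hwu : w = u
    · have h1 : ¬ G.Adj v w := fun h => hvp ((hu v).1 (hwu ▸ h.symm))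
      simp [h1, SimpleGraph.deleteIncidenceSet_adj]
    · simp [hwp, hwu, hvp, SimpleGraph.deleteIncidenceSet_adj]

theorem leaf_neighbor_notMem_supp [Finite V] : p ∉ supp G := by
  rintro ⟨x, hx, h⟩
  exact h (nullSpace_apply_eq_zero_of_leaf hu hx)

theorem mem_supp_deleteIncidenceSet_of_leaf [Finite V] {v : V} (hv : v ∈ supp G) :
    v ∈ supp (G.deleteIncidenceSet p) := by
  obtain ⟨x, hx, h⟩ := hv
  exact ⟨x, mem_nullSpace_deleteIncidenceSet_of_leaf hu hx, h⟩

theorem mem_supp_of_leaf [Finite V] {v : V} (hvp : v ≠ p) (hvu : v ≠ u)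
    (hv : v ∈ supp (G.deleteIncidenceSet p)) : v ∈ supp G := by
  have := Fintype.ofFinite V
  obtain ⟨x, hx, h⟩ := hv
  exact ⟨_, extend_mem_nullSpace_of_leaf hu hx, by simpa [hvp, hvu] using h⟩

theorem exists_mem_supp_of_leaf_mem_supp [Finite V] (h : u ∈ supp G) :
    ∃ w, G.Adj p w ∧ w ≠ u ∧ w ∈ supp G := by
  classical
  have := Fintype.ofFinite V
  obtain ⟨x, hx, hxu⟩ := h
  by_contra! hcon
  apply hxu
  have h1 := mem_nullSpace_iff.1 hx p
  rw [Finset.sum_eq_single u] at h1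
  · simpa [((hu p).2 rfl).symm] using h1
  · intro w _ hwu
    split_ifs with hw
    · by_contra hne
      exact hcon w hw hwu ⟨x, hx, hne⟩
    · rfl
  · simp

/-- Cut a null vector down to the component of `w` after deletion. In a forest `w` is the only
neighbour of `p` there, so nothing cancels `x w` at `p` and the extension takes the nonzero value
`-x w` at `u`. -/
theorem leaf_mem_supp_of_isAcyclic [Finite V] (hG : G.IsAcyclic) {w : V} (hpw : G.Adj p w)
    (hwu : w ≠ u) (hw : w ∈ supp G) : u ∈ supp G := by
  classical
  have := Fintype.ofFinite V
  obtain ⟨x, hx, hxw⟩ := hw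
  have hx' := mem_nullSpace_deleteIncidenceSet_of_leaf hu hx
  set H := G.deleteIncidenceSet p with hH
  have hy : (fun v => if H.Reachable w v then x v else 0) ∈ nullSpace H := by
    rw [mem_nullSpace_iff] at hx' ⊢
    intro v
    by_cases hv : H.Reachable w v
    · refine Eq.trans ?_ (hx' v)
      refine Finset.sum_congr rfl fun t _ => ?_
      split_ifs with h1 h2
      · rfl
      · exact absurd (hv.trans h1.reachable) h2
      · rfl
    · refine Finset.sum_eq_zero fun t _ => ?_
      split_ifs with h1 h2
      · exact absurd (h2.trans h1.symm.reachable) hv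
      · rfl
      · rfl
  -- A second neighbour of `p` in this component would give a way from `p` to `w` avoiding the edge
  -- `pw`, which is a bridge.
  have hsep : ∀ t, G.Adj p t → H.Reachable w t → t = w := by
    intro t ht hwt
    by_contra htw
    have hb := SimpleGraph.isAcyclic_iff_forall_adj_isBridge.1 hG hpw
    rw [SimpleGraph.isBridge_iff] at hb
    apply hb
    have hle : H ≤ G.deleteEdges {s(p, w)} := by
      intro a b hab
      rw [SimpleGraph.deleteIncidenceSet_adj] at hab
      rw [SimpleGraph.deleteEdges_adj]
      refine ⟨hab.1, fun h => ?_⟩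
      rcases Sym2.eq_iff.1 h with ⟨h, -⟩ | ⟨-, h⟩
      exacts [hab.2.1 h, hab.2.2 h]
    have h1 : (G.deleteEdges {s(p, w)}).Adj p t := by
      rw [SimpleGraph.deleteEdges_adj]
      exact ⟨ht, fun h => htw (Sym2.congr_right.1 h)⟩
    exact h1.reachable.trans (hwt.mono hle).symm
  refine ⟨_, extend_mem_nullSpace_of_leaf hu hy, ?_⟩
  have hup : u ≠ p := ((hu p).2 rfl).ne
  simp only [hup, if_false, if_true, ne_eq, neg_eq_zero]
  rw [Finset.sum_eq_single w]
  · simpa [hpw, hwu] using hxw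
  · intro t _ htw
    split_ifs with h1 h2
    · exact absurd (hsep t h1.1 h2) htw
    · rfl
    · rfl
  · simp

theorem two_mul_core_add_nForest_of_leaf [Finite V] (hG : G.IsAcyclic) :
    2 * (core G).ncard + (nForestVerts G).ncard =
      2 * (core (G.deleteIncidenceSet p)).ncard +
        (nForestVerts (G.deleteIncidenceSet p)).ncard + 2 := by
  have hup : G.Adj u p := (hu p).2 rfl
  set H := G.deleteIncidenceSet p with hH
  have hsupp : ∀ v, v ≠ p → v ≠ u → (v ∈ supp H ↔ v ∈ supp G) := fun v h1 h2 =>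
    ⟨mem_supp_of_leaf hu h1 h2, mem_supp_deleteIncidenceSet_of_leaf hu⟩
  have hp : p ∉ supp G := leaf_neighbor_notMem_supp hu
  -- The deletion keeps the vertex set; isolated vertices lie in the support, so `u` and `p` count
  -- neither in the core nor in the N-forest of `H`.
  have hisol : ∀ v, (∀ w, ¬ H.Adj v w) → v ∈ supp H := by
    classical
    have := Fintype.ofFinite V
    refine fun v hv => ⟨Pi.single v 1, mem_nullSpace_iff.2 fun w => ?_, by simp⟩
    refine Finset.sum_eq_zero fun t _ => ?_
    split_ifs with h
    · exact Pi.single_eq_of_ne (by rintro rfl; exact hv w h.symm) _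
    · rfl
  have hHp : ∀ w, ¬ H.Adj p w := fun w h => (SimpleGraph.deleteIncidenceSet_adj.1 h).2.1 rfl
  have hHu : ∀ w, ¬ H.Adj u w := fun w h => by
    have := SimpleGraph.deleteIncidenceSet_adj.1 h
    exact this.2.2 ((hu w).1 this.1)
  have hcoreHp : p ∉ core H := fun h => by
    obtain ⟨v, -, h⟩ := mem_core_iff.1 h
    exact hHp v h.symm
  have hcoreu : u ∉ core G := fun h => by
    obtain ⟨v, hv, h⟩ := mem_core_iff.1 h
    exact hp ((hu v).1 h.symm ▸ hv)
  have hcoreHu : u ∉ core H := fun h => by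
    obtain ⟨v, -, h⟩ := mem_core_iff.1 h
    exact hHu v h.symm
  have hcore : ∀ w, w ≠ p → w ≠ u → (w ∈ core H ↔ w ∈ core G) := by
    intro w hwp hwu
    rw [mem_core_iff, mem_core_iff]
    constructor
    · rintro ⟨v, hv, h⟩
      have hvu : v ≠ u := fun h' => hHu w (h' ▸ h)
      have h' := SimpleGraph.deleteIncidenceSet_adj.1 h
      exact ⟨v, (hsupp v h'.2.1 hvu).1 hv, h'.1⟩
    · rintro ⟨v, hv, h⟩
      exact ⟨v, mem_supp_deleteIncidenceSet_of_leaf hu hv,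
        SimpleGraph.deleteIncidenceSet_adj.2 ⟨h, fun h' => hp (h' ▸ hv), hwp⟩⟩
  have hNH : p ∉ nForestVerts H ∧ u ∉ nForestVerts H :=
    ⟨fun h => (mem_nForestVerts_iff.1 h).1 (hisol p hHp),
      fun h => (mem_nForestVerts_iff.1 h).1 (hisol u hHu)⟩
  have hN : ∀ w, w ≠ p → w ≠ u → (w ∈ nForestVerts H ↔ w ∈ nForestVerts G) := fun w h1 h2 => by
    rw [mem_nForestVerts_iff, mem_nForestVerts_iff, hsupp w h1 h2, hcore w h1 h2]
  by_cases hus : u ∈ supp G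
  · have hpc : p ∈ core G := mem_core_iff.2 ⟨u, hus, hup⟩
    have h1 : core G = insert p (core H) := by
      ext w
      by_cases hwp : w = p
      · simp [hwp, hpc]
      by_cases hwu : w = u
      · simp [hwu, hup.ne, hcoreu, hcoreHu]
      · simp [hwp, hcore w hwp hwu]
    have h2 : nForestVerts G = nForestVerts H := by
      ext w
      by_cases hwp : w = p
      · subst hwp
        simp [hNH.1, mem_nForestVerts_iff, hpc]
      by_cases hwu : w = u
      · subst hwu
        simp [hNH.2, mem_nForestVerts_iff, hus]
      · exact (hN w hwp hwu).symm
    rw [h1, h2, Set.ncard_insert_of_notMem hcoreHp (Set.toFinite _)]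
    ring
  -- Acyclicity enters only here: a supported neighbour of `p` would put `u` into the support.
  · have hpc : p ∉ core G := fun h => by
      obtain ⟨v, hv, h⟩ := mem_core_iff.1 h
      exact hus (leaf_mem_supp_of_isAcyclic hu hG h.symm (fun h' => hus (h' ▸ hv)) hv)
    have h1 : core G = core H := by
      ext w
      by_cases hwp : w = p
      · simp [hwp, hpc, hcoreHp]
      by_cases hwu : w = u
      · simp [hwu, hcoreu, hcoreHu]
      · exact (hcore w hwp hwu).symm
    have h2 : nForestVerts G = insert p (insert u (nForestVerts H)) := by
      ext w
      by_cases hwp : w = p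
      · simp [hwp, mem_nForestVerts_iff, hp, hpc]
      by_cases hwu : w = u
      · simp [hwu, mem_nForestVerts_iff, hus, hcoreu]
      · simp [hwp, hwu, hN w hwp hwu]
    rw [h1, h2, Set.ncard_insert_of_notMem (by simp [hup.ne.symm, hNH.1]) (Set.toFinite _),
      Set.ncard_insert_of_notMem hNH.2 (Set.toFinite _)]
    ring

end Leaf

/-! ### The matching number of a forest -/

theorem matchingNumber_bot [Finite V] : matchingNumber (⊥ : SimpleGraph V) = 0 := by
  obtain ⟨M, hM, hc⟩ := exists_isEdgeMatching_ncard_eq (⊥ : SimpleGraph V)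
  have := hM.subset
  rw [SimpleGraph.edgeSet_bot, Set.subset_empty_iff] at this
  rw [← hc, this, Set.ncard_empty]

theorem supp_bot [Finite V] : supp (⊥ : SimpleGraph V) = Set.univ := by
  have := Fintype.ofFinite V
  refine Set.eq_univ_of_forall fun v => ⟨fun _ => 1, mem_nullSpace_iff.2 fun w => ?_, one_ne_zero⟩
  simp

/-- The matching number of a forest in terms of its null decomposition. -/
theorem two_mul_matchingNumber_of_isAcyclic [Finite V] (hG : G.IsAcyclic) :
    2 * matchingNumber G = 2 * (core G).ncard + (nForestVerts G).ncard := by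
  -- The vertex type never shrinks, so the induction runs on the matching number.
  induction hn : matchingNumber G generalizing G with
  | zero =>
    by_cases hne : G = ⊥
    · subst hne
      have h1 : core (⊥ : SimpleGraph V) = ∅ := by
        ext w
        simp [mem_core_iff]
      have h2 : nForestVerts (⊥ : SimpleGraph V) = ∅ := by
        ext w
        simp [mem_nForestVerts_iff, supp_bot]
      simp [h1, h2]
    · obtain ⟨u, p, hu⟩ := exists_leaf hG hne
      rw [matchingNumber_deleteIncidenceSet_of_leaf hu] at hn
      omega
  | succ n ih =>
    have hne : G ≠ ⊥ := by
      rintro rfl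
      rw [matchingNumber_bot] at hn
      omega
    obtain ⟨u, p, hu⟩ := exists_leaf hG hne
    rw [matchingNumber_deleteIncidenceSet_of_leaf hu] at hn
    rw [two_mul_core_add_nForest_of_leaf hu hG,
      ← ih (hG.anti (G.deleteIncidenceSet_le p)) (by omega)]
    ring

/-! ### The cycle and its pendant trees -/

theorem IsCycleSubgraph.nonempty {C : G.Subgraph} (hC : IsCycleSubgraph C) : C.verts.Nonempty := by
  obtain ⟨a, p, -, rfl⟩ := hC
  exact ⟨a, p.start_mem_verts_toSubgraph⟩

theorem IsCycleSubgraph.exists_walk {C : G.Subgraph} (hC : IsCycleSubgraph C) {v w : V}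
    (hv : v ∈ C.verts) (hw : w ∈ C.verts) : ∃ q : G.Walk v w, ∀ x ∈ q.support, x ∈ C.verts := by
  classical
  obtain ⟨a, p, -, rfl⟩ := hC
  rw [SimpleGraph.Walk.mem_verts_toSubgraph] at hv hw
  refine ⟨(p.takeUntil v hv).reverse.append (p.takeUntil w hw), fun x hx => ?_⟩
  rw [SimpleGraph.Walk.mem_verts_toSubgraph]
  rw [SimpleGraph.Walk.mem_support_append_iff, SimpleGraph.Walk.support_reverse,
    List.mem_reverse] at hx
  rcases hx with hx | hx
  exacts [p.support_takeUntil_subset_support hv hx, p.support_takeUntil_subset_support hw hx]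

/-- A cycle has a matching that covers all but at most one of its vertices. -/
theorem IsCycleSubgraph.exists_isEdgeMatching [Finite V] {C : G.Subgraph}
    (hC : IsCycleSubgraph C) :
    ∃ M, IsEdgeMatching G M ∧ C.verts.ncard / 2 ≤ M.ncard ∧ ∀ e ∈ M, ∀ v ∈ e, v ∈ C.verts := by
  classical
  obtain ⟨a, p, hp, rfl⟩ := hC
  have hcard : p.toSubgraph.verts.ncard ≤ p.length := by
    have h1 : p.toSubgraph.verts ⊆ ↑p.support.tail.toFinset := by
      intro w hw
      rw [SimpleGraph.Walk.mem_verts_toSubgraph, SimpleGraph.Walk.mem_support_iff] at hw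
      rw [Finset.mem_coe, List.mem_toFinset]
      rcases hw with rfl | hw
      exacts [SimpleGraph.Walk.end_mem_tail_support hp.not_nil, hw]
    refine (Set.ncard_le_ncard h1 (Finset.finite_toSet _)).trans ?_
    rw [Set.ncard_coe_finset]
    refine (List.toFinset_card_le _).trans ?_
    simp
  -- Every second edge of the cycle. The indices stay at most `p.length - 1`, where `getVert` is
  -- injective; the repeated endpoint is never reached.
  let f : Fin (p.length / 2) → Sym2 V := fun i => s(p.getVert (2 * i), p.getVert (2 * i + 1))
  have hinj : ∀ i j : Fin (p.length / 2), ∀ v, v ∈ f i → v ∈ f j → i = j := by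
    intro i j v hi hj
    have h1 : ∃ m, v = p.getVert m ∧ m / 2 = i ∧ m ≤ p.length - 1 := by
      rcases Sym2.mem_iff.1 hi with h | h
      exacts [⟨_, h, by omega, by omega⟩, ⟨_, h, by omega, by omega⟩]
    have h2 : ∃ m, v = p.getVert m ∧ m / 2 = j ∧ m ≤ p.length - 1 := by
      rcases Sym2.mem_iff.1 hj with h | h
      exacts [⟨_, h, by omega, by omega⟩, ⟨_, h, by omega, by omega⟩]
    obtain ⟨m, hm, hmi, hml⟩ := h1
    obtain ⟨n, hn, hnj, hnl⟩ := h2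
    have : m = n := hp.getVert_injOn' hml hnl (hm.symm.trans hn)
    exact Fin.ext (by omega)
  refine ⟨Set.range f, ⟨?_, ?_⟩, ?_, ?_⟩
  · rintro _ ⟨i, rfl⟩
    exact p.adj_getVert_succ (by omega)
  · rintro _ ⟨i, rfl⟩ _ ⟨j, rfl⟩ v hi hj
    rw [hinj i j v hi hj]
  · have hf : Function.Injective f := fun i j hij =>
      hinj i j _ (Sym2.out_fst_mem _) (hij ▸ Sym2.out_fst_mem _)
    rw [← Set.image_univ, Set.ncard_image_of_injective _ hf, Set.ncard_univ, Nat.card_fin]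
    exact Nat.div_le_div_right hcard
  · rintro _ ⟨i, rfl⟩ v hv
    rw [SimpleGraph.Walk.mem_verts_toSubgraph]
    rcases Sym2.mem_iff.1 hv with rfl | rfl <;> exact p.getVert_mem_support _

theorem mem_pendantVerts_of_adj {C : G.Subgraph} {v a b : V} (ha : a ∈ pendantVerts C v)
    (hab : G.Adj a b) (hb : b ∉ C.verts) : b ∈ pendantVerts C v := by
  obtain ⟨p, hp⟩ := ha
  refine ⟨p.concat hab, fun x hx hxC => ?_⟩
  rw [SimpleGraph.Walk.support_concat, List.mem_append,
    List.mem_singleton] at hx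
  rcases hx with hx | rfl
  exacts [hp x hx hxC, absurd hxC hb]

theorem eq_of_mem_pendantVerts {C : G.Subgraph} {v x : V} (hx : x ∈ pendantVerts C v)
    (hxC : x ∈ C.verts) : x = v :=
  (isGreatest_pendantVerts C v).1.2.2 x hx hxC

theorem exists_mem_pendantVerts {C : G.Subgraph} {x y : V} (p : G.Walk x y) (hy : y ∈ C.verts) :
    ∃ v ∈ C.verts, x ∈ pendantVerts C v := by
  induction p with
  | nil => exact ⟨_, hy, self_mem_pendantVerts C _⟩
  | @cons x z y h q ih =>
    by_cases hx : x ∈ C.verts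
    · exact ⟨x, hx, self_mem_pendantVerts C _⟩
    · obtain ⟨v, hv, hz⟩ := ih hy
      exact ⟨v, hv, mem_pendantVerts_of_adj hz h.symm hx⟩

/-- A walk from `a` to the cycle, which exists by connectedness, determines the tree containing the
edge. -/
theorem exists_mem_pendantVerts_of_adj {C : G.Subgraph} (hG : G.Connected)
    (hC : C.verts.Nonempty) {a b : V} (hab : G.Adj a b) (ha : a ∉ C.verts) :
    ∃ v ∈ C.verts, a ∈ pendantVerts C v ∧ b ∈ pendantVerts C v := by
  by_cases hb : b ∈ C.verts
  · exact ⟨b, hb, mem_pendantVerts_of_adj (self_mem_pendantVerts C b) hab.symm ha,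
      self_mem_pendantVerts C b⟩
  · obtain ⟨y, hy⟩ := hC
    obtain ⟨p⟩ := hG.preconnected a y
    obtain ⟨v, hv, h⟩ := exists_mem_pendantVerts p hy
    exact ⟨v, hv, h, mem_pendantVerts_of_adj h hab hb⟩

/-- In a unicyclic graph, distinct pendant trees are disjoint. -/
theorem eq_of_mem_pendantVerts_of_mem_pendantVerts (hG : IsUnicyclic G) {C : G.Subgraph}
    (hC : IsCycleSubgraph C) {v w x : V} (hv : v ∈ C.verts) (hw : w ∈ C.verts)
    (hxv : x ∈ pendantVerts C v) (hxw : x ∈ pendantVerts C w) : v = w := by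
  classical
  by_cases hx : x ∈ C.verts
  · exact (eq_of_mem_pendantVerts hxv hx).symm.trans (eq_of_mem_pendantVerts hxw hx)
  by_contra hvw
  obtain ⟨p, hp⟩ := hxv
  obtain ⟨r, hr⟩ := hxw
  obtain ⟨c, hc⟩ := hC.exists_walk hv hw
  have hpath := p.bypass_isPath
  have hp' : ∀ y ∈ p.bypass.support, y ∈ C.verts → y = v :=
    fun y hy => hp y (p.support_bypass_subset_support hy)
  generalize p.bypass = q at hpath hp'
  cases q with
  | nil => exact hx hv
  | @cons _ a _ h q =>
    rw [SimpleGraph.Walk.cons_isPath_iff] at hpath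
    have ha : a ∉ C.verts := fun haC => h.ne
      (hp' a (List.mem_cons_of_mem _ q.start_mem_support) haC).symm
    have hvr : v ∉ r.support := fun h' => hvw (hr v h' hv)
    -- Going from `v` along `C` to `w`, then to `x` and back to `a` avoids the edge `va`. Hence `va`
    -- lies on a cycle, which must be `C`, although `a` is outside `C`.
    have hnot : s(v, a) ∉ ((c.append r).append q.reverse).edges := by
      rw [SimpleGraph.Walk.edges_append, SimpleGraph.Walk.edges_append,
        SimpleGraph.Walk.edges_reverse, List.mem_append, List.mem_append, List.mem_reverse]
      rintro ((h' | h') | h')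
      · exact ha (hc a (c.snd_mem_support_of_mem_edges h'))
      · exact hvr (r.fst_mem_support_of_mem_edges h')
      · exact hpath.2 (q.fst_mem_support_of_mem_edges h')
    obtain ⟨b, d, hd, he⟩ := SimpleGraph.adj_and_reachable_delete_edges_iff_exists_cycle.1
      ⟨h, SimpleGraph.reachable_deleteEdges_iff_exists_walk.2 ⟨_, hnot⟩⟩
    have hdC : d.toSubgraph = C := hG.2.unique ⟨b, d, hd, rfl⟩ hC
    rw [← hdC, SimpleGraph.Walk.mem_verts_toSubgraph] at ha
    exact ha (d.snd_mem_support_of_mem_edges he)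

/-- A cycle of `G - C` would be a cycle of `G` disjoint from the only one. -/
theorem deleteCycle_isAcyclic (hG : IsUnicyclic G) {C : G.Subgraph}
    (hC : IsCycleSubgraph C) : (deleteCycle C).IsAcyclic := by
  intro a p hp
  let f : deleteCycle C →g G := (SimpleGraph.Embedding.induce (C.verts)ᶜ).toHom
  have hf : Function.Injective f := Subtype.val_injective
  have h : (p.map f).toSubgraph = C := hG.2.unique ⟨_, _, hp.map hf, rfl⟩ hC
  have ha : f a ∈ C.verts :=
    h.le.1 (SimpleGraph.Walk.start_mem_verts_toSubgraph _)
  exact a.2 ha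

/-! ### Type II and the splitting of the matching number -/

theorem IsMismatched.exists_isEdgeMatching [Finite V] {v : V} (h : IsMismatched G v) :
    ∃ M, IsEdgeMatching G M ∧ M.ncard = matchingNumber G ∧ ∀ e ∈ M, v ∉ e := by
  rcases h with h | ⟨M, hM, hv⟩
  -- With a single vertex there are no edges, so the maximum matching is empty.
  · obtain ⟨M, hM, hc⟩ := exists_isEdgeMatching_ncard_eq G
    refine ⟨M, hM, hc, fun e he => ?_⟩
    have := (Nat.card_eq_one_iff_unique.1 h).1
    have he' := hM.subset he
    induction e with
    | _ a b => exact absurd (Subsingleton.elim a b) (G.ne_of_adj he')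
  · refine ⟨M.edgeSet, isEdgeMatching_edgeSet hM.1, hM.ncard_eq, fun e he hve => hv ?_⟩
    exact SimpleGraph.Subgraph.mem_verts_of_mem_edge he hve

-- Type II is used here: a maximum matching of each pendant tree can avoid the root, its only vertex
-- on `C`, and so survives in `G - C`.
open Classical in
theorem sum_matchingNumber_pendantTree_le [Fintype V] (hG : IsUnicyclic G) {C : G.Subgraph}
    (hC : IsCycleSubgraph C) (hII : IsTypeII C) :
    ∑ v : C.verts, matchingNumber (pendantTree C v.1) ≤ matchingNumber (deleteCycle C) := by
  have hex : ∀ v : C.verts, ∃ M, IsEdgeMatching G M ∧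
      M.ncard = matchingNumber (pendantTree C v.1) ∧
      ∀ e ∈ M, ∀ x ∈ e, x ∈ pendantVerts C v.1 ∧ x ∉ C.verts := by
    intro v
    have hm : IsMismatched (pendantTree C v.1) ⟨v.1, self_mem_pendantVerts C v.1⟩ := by
      by_contra h
      exact hII ⟨v.1, v.2, h⟩
    obtain ⟨M, hM, hc, hv⟩ := hm.exists_isEdgeMatching
    obtain ⟨h1, h2, h3⟩ := IsEdgeMatching.image_val (S := pendantVerts C v.1) hM
    refine ⟨_, h1, h2.trans hc, fun e he x hx => ?_⟩
    obtain ⟨hxS, f, hf, hxf⟩ := (h3 x).1 ⟨e, he, hx⟩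
    refine ⟨hxS, fun hxC => hv f hf ?_⟩
    have := eq_of_mem_pendantVerts hxS hxC
    subst this
    exact hxf
  choose M hM hc hS using hex
  obtain ⟨h1, h2⟩ := IsEdgeMatching.iUnion hM fun v w hvw e he f hf x hxe hxf => hvw <|
    Subtype.ext <| eq_of_mem_pendantVerts_of_mem_pendantVerts hG hC v.2 w.2
      (hS v e he x hxe).1 (hS w f hf x hxf).1
  have h3 : (⋃ v, M v).ncard ≤ matchingNumber (deleteCycle C) := by
    refine h1.ncard_le_induce fun e he x hx => ?_
    obtain ⟨v, he⟩ := Set.mem_iUnion.1 he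
    exact (hS v e he x hx).2
  rwa [h2, Finset.sum_congr rfl fun v _ => hc v] at h3

theorem matchingNumber_le_cycle_add [Finite V] (hG : IsUnicyclic G) {C : G.Subgraph}
    (hC : IsCycleSubgraph C) (hII : IsTypeII C) :
    matchingNumber G ≤ C.verts.ncard / 2 + matchingNumber (deleteCycle C) := by
  classical
  have := Fintype.ofFinite V
  obtain ⟨M, hM, hc⟩ := exists_isEdgeMatching_ncard_eq G
  -- An edge with an end outside `C` lies inside one pendant tree, even if its other end is on `C`.
  have hU : M ⊆ edgesWithin M C.verts ∪ ⋃ v : C.verts, edgesWithin M (pendantVerts C v.1) := by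
    intro e he
    induction e with
    | _ a b =>
      have hab : G.Adj a b := hM.subset he
      by_cases ha : a ∈ C.verts
      · by_cases hb : b ∈ C.verts
        · refine Or.inl ⟨he, fun x hx => ?_⟩
          rcases Sym2.mem_iff.1 hx with rfl | rfl <;> assumption
        · obtain ⟨v, hv, h1, h2⟩ := exists_mem_pendantVerts_of_adj hG.1 hC.nonempty hab.symm hb
          refine Or.inr (Set.mem_iUnion.2 ⟨⟨v, hv⟩, he, fun x hx => ?_⟩)
          rcases Sym2.mem_iff.1 hx with rfl | rfl <;> assumption
      · obtain ⟨v, hv, h1, h2⟩ := exists_mem_pendantVerts_of_adj hG.1 hC.nonempty hab ha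
        refine Or.inr (Set.mem_iUnion.2 ⟨⟨v, hv⟩, he, fun x hx => ?_⟩)
        rcases Sym2.mem_iff.1 hx with rfl | rfl <;> assumption
  have h1 : (edgesWithin M C.verts).ncard ≤ C.verts.ncard / 2 := by
    have := (hM.edgesWithin C.verts).two_mul_ncard_le fun e he => he.2
    omega
  have h2 : (⋃ v : C.verts, edgesWithin M (pendantVerts C v.1)).ncard ≤
      matchingNumber (deleteCycle C) := by
    refine (Set.ncard_iUnion_le_of_fintype _).trans
      (le_trans (Finset.sum_le_sum fun v _ => ?_) (sum_matchingNumber_pendantTree_le hG hC hII))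
    exact (hM.edgesWithin _).ncard_le_induce fun e he => he.2
  rw [← hc]
  exact (Set.ncard_le_ncard hU (Set.toFinite _)).trans
    ((Set.ncard_union_le _ _).trans (add_le_add h1 h2))

theorem cycle_add_le_matchingNumber [Finite V] {C : G.Subgraph} (hC : IsCycleSubgraph C) :
    C.verts.ncard / 2 + matchingNumber (deleteCycle C) ≤ matchingNumber G := by
  obtain ⟨M, hM, hc, hMC⟩ := hC.exists_isEdgeMatching
  obtain ⟨N, hN, hc', hNC⟩ := exists_isEdgeMatching_induce G (C.verts)ᶜ
  obtain ⟨h1, h2⟩ := IsEdgeMatching.iUnion (M := fun b : Bool => if b then M else N)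
    (by rintro (_ | _) <;> simpa) (by
      rintro (_ | _) (_ | _) hij e he f hf v hve hvf
      · exact hij rfl
      · exact hNC e he v hve (hMC f hf v hvf)
      · exact hNC f hf v hvf (hMC e he v hve)
      · exact hij rfl)
  have h3 := h1.ncard_le
  rw [h2, Fintype.sum_bool] at h3
  simp only [if_true, Bool.false_eq_true, if_false] at h3
  rw [hc'] at h3
  exact (Nat.add_le_add_right hc _).trans h3

end UnicyclicMatching

theorem mainTheorem5 {V : Type*} [Finite V] (G : SimpleGraph V)
    (hG : UnicyclicMatching.IsUnicyclic G)
    (C : G.Subgraph) (hC : UnicyclicMatching.IsCycleSubgraph C)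
    (hII : UnicyclicMatching.IsTypeII C)
    (k : ℕ) (T : Fin k ≃ (UnicyclicMatching.deleteCycle C).ConnectedComponent) :
    (UnicyclicMatching.matchingNumber G : ℚ) =
      (⌊(C.verts.ncard : ℚ) / 2⌋ : ℚ) +
        ∑ i : Fin k,
          (((UnicyclicMatching.core (T i).toSimpleGraph).ncard : ℚ) +
            ((UnicyclicMatching.nForestVerts (T i).toSimpleGraph).ncard : ℚ) / 2) := by
  have hν := le_antisymm (UnicyclicMatching.matchingNumber_le_cycle_add hG hC hII)
    (UnicyclicMatching.cycle_add_le_matchingNumber hC)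
  have hacyc := UnicyclicMatching.deleteCycle_isAcyclic hG hC
  -- The rational floor agrees with the natural-number division used in the two bounds.
  have hfloor : ⌊(C.verts.ncard : ℚ) / 2⌋ = ((C.verts.ncard / 2 : ℕ) : ℤ) := by
    have := Rat.floor_intCast_div_natCast (C.verts.ncard : ℤ) 2
    push_cast at this ⊢
    exact this
  rw [hν, UnicyclicMatching.matchingNumber_eq_sum T, hfloor]
  push_cast
  congr 1
  refine Finset.sum_congr rfl fun i _ => ?_
  have h := UnicyclicMatching.two_mul_matchingNumber_of_isAcyclic
    (hacyc.isTree_connectedComponent (T i)).isAcyclic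
  have h' : (2 : ℚ) * UnicyclicMatching.matchingNumber (T i).toSimpleGraph =
      2 * (UnicyclicMatching.core (T i).toSimpleGraph).ncard +
        (UnicyclicMatching.nForestVerts (T i).toSimpleGraph).ncard := by
    exact_mod_cast h
  linarith
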